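/- Let $p$ be a prime, $w\ge 1$, $\ell=p^w$, $q=\ell^2$, and let $m\ge 1$. Let $T_m=\mathbb{F}_q(y_1,\dots,y_m)$ be the $m$-th field of the Garcia–Stichtenoth tower: $T_1=\mathbb{F}_q(y_1)$ is the rational function field and $T_i=T_{i-1}(y_i)$ with $$y_i^{\ell}+y_i=\frac{y_{i-1}^{\ell}}{y_{i-1}^{\ell-1}+1}\qquad(2\le i\le m).$$ Let $\mathcal{A}$ be the group of automorphisms $\sigma$ of $T_m$ over $\mathbb{F}_q$ of the form $\sigma(y_i)=cy_i$ for $1\le i\le m-1$ and $\sigma(y_m)=cy_m+a$, where $c\in\mathbb{F}_\ell^*$ and $a\in\mathbb{F}_q$ with $a^\ell+a=0$. Let $v$ be an integer with $0\le v\le w$, and let $u$ be a positive integer with $u\mid\gcd(p^v-1,\ell-1)$. Let $H$ be the subgroup of order $u$ of $\mathbb{F}_\ell^*$, let $h$ be the least positive integer with $u\mid p^h-1$, and let $W$ be an $\mathbb{F}_{p^h}$-subspace of $\{a\in\mathbb{F}_q:a^\ell+a=0\}$ of dimension $v/h$. Put $$H_1=\{\sigma\in\mathcal{A}:\sigma(y_i)=y_i\text{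 for }1\le i\le m-1,\ \sigma(y_m)=y_m+a\text{ for some }a\in W\},$$ $$H_2=\{\sigma\in\mathcal{A}:\text{there is } c\in H\text{ with }\sigma(y_i)=cy_i\text{ for all }1\le i\le m\}.$$ Then $G=H_1H_2$ is a subgroup of $\mathcal{A}$, it is the (internal) semidirect product $H_1\rtimes H_2$ of its normal subgroup $H_1$ and its subgroup $H_2$, and $|H_1|=p^v$, $|H_2|=u$, $|G|=up^v$. -/

import Mathlib

open scoped Pointwise

namespace GSTower

/-- The subfield `{x ∈ K : x ^ (p ^ n) = x}` of a field `K` of characteristic `p`; it is the field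
with `p ^ n` elements when `K` is finite of order `p ^ N` and `n` is a positive divisor of `N`. -/
def frobeniusFixed (K : Type*) [Field K] (p n : ℕ) [Fact p.Prime] [CharP K p] : Subfield K :=
  (iterateFrobenius K p n).eqLocusField (RingHom.id K)

theorem mem_frobeniusFixed {K : Type*} [Field K] {p n : ℕ} [Fact p.Prime] [CharP K p] {x : K} :
    x ∈ frobeniusFixed K p n ↔ x ^ p ^ n = x := Iff.rfl

/-- The elements `y 1, …, y m` of a field extension of `K` are generators of the first `m` steps of
the Garcia-Stichtenoth tower: `y 1` is a variable over `K`, and each `y i` with `2 ≤ i ≤ m` is a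
root of the equation over `K(y 1, …, y (i - 1))` that defines the tower. (As `y 1` is
transcendental, so is every `y i`, and no denominator vanishes.) The value `y 0` plays no role. -/
structure IsTower (K : Type*) [Field K] {Ω : Type*} [Field Ω] [Algebra K Ω] (l m : ℕ)
    (y : ℕ → Ω) : Prop where
  transcendental : Transcendental K (y 1)
  equation : ∀ i, 2 ≤ i → i ≤ m →
    y i ^ l + y i = y (i - 1) ^ l / (y (i - 1) ^ (l - 1) + 1)

/-- The field `T_m = K(y 1, …, y m)`. -/
def T (K : Type*) [Field K] {Ω : Type*} [Field Ω] [Algebra K Ω] (y : ℕ → Ω) (m : ℕ) :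
    IntermediateField K Ω :=
  IntermediateField.adjoin K (y '' Set.Icc 1 m)

section

variable {K : Type*} [Field K] {Ω : Type*} [Field Ω] [Algebra K Ω] (y : ℕ → Ω) (m : ℕ)

/-- The generator `y i`, for `1 ≤ i ≤ m`, as an element of `T_m`. -/
def gen (i : Set.Icc 1 m) : T K y m :=
  ⟨y i, IntermediateField.subset_adjoin K _ ⟨i, i.2, rfl⟩⟩

/-- The automorphism `σ` of `T_m` over `K` satisfies `σ (y i) = c * y i` for `1 ≤ i ≤ m - 1` and
`σ (y m) = c * y m + a`. -/
def ActsBy (σ : T K y m ≃ₐ[K] T K y m) (c : Kˣ) (a : K) : Prop :=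
  (∀ i : Set.Icc 1 m, (i : ℕ) < m → σ (gen y m i) = algebraMap K _ (c : K) * gen y m i) ∧
  (∀ i : Set.Icc 1 m, (i : ℕ) = m →
    σ (gen y m i) = algebraMap K _ (c : K) * gen y m i + algebraMap K _ a)

variable {y m}

theorem ActsBy.one : ActsBy y m (1 : T K y m ≃ₐ[K] T K y m) 1 0 := by
  constructor <;> intro i _ <;> simp

theorem ActsBy.mul {σ τ : T K y m ≃ₐ[K] T K y m} {c d : Kˣ} {a b : K}
    (hσ : ActsBy y m σ c a) (hτ : ActsBy y m τ d b) :
    ActsBy y m (σ * τ) (c * d) (d * a + b) := by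
  constructor
  · intro i hi
    rw [AlgEquiv.mul_apply, hτ.1 i hi, map_mul, hσ.1 i hi, AlgEquiv.commutes]
    push_cast [map_mul]
    ring
  · intro i hi
    rw [AlgEquiv.mul_apply, hτ.2 i hi, map_add, map_mul, hσ.2 i hi, AlgEquiv.commutes,
      AlgEquiv.commutes]
    push_cast [map_mul, map_add]
    ring

theorem ActsBy.inv {σ : T K y m ≃ₐ[K] T K y m} {c : Kˣ} {a : K} (hσ : ActsBy y m σ c a) :
    ActsBy y m σ⁻¹ c⁻¹ (-((c⁻¹ : Kˣ) * a)) := by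
  have hc : algebraMap K (T K y m) ((c⁻¹ : Kˣ) : K) * algebraMap K (T K y m) (c : K) = 1 := by
    rw [← map_mul, Units.inv_mul, map_one]
  constructor
  · intro i hi
    apply σ.injective
    rw [← AlgEquiv.mul_apply, mul_inv_cancel, AlgEquiv.one_apply, map_mul, AlgEquiv.commutes,
      hσ.1 i hi, ← mul_assoc, hc, one_mul]
  · intro i hi
    apply σ.injective
    rw [← AlgEquiv.mul_apply, mul_inv_cancel, AlgEquiv.one_apply, map_add, map_mul,
      AlgEquiv.commutes, AlgEquiv.commutes, hσ.2 i hi, mul_add, ← mul_assoc, hc, one_mul, map_neg,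
      map_mul]
    ring

variable (y m)

/-- The group of automorphisms `σ` of `T_m` over `K` with `σ (y i) = c * y i` for `i < m` and
`σ (y m) = c * y m + a`, where `c` is a nonzero element of the field of order `p ^ w` and
`a ^ (p ^ w) + a = 0`. -/
def affineGroup (p w : ℕ) [Fact p.Prime] [CharP K p] : Subgroup (T K y m ≃ₐ[K] T K y m) where
  carrier := {σ | ∃ (c : Kˣ) (a : K),
    (c : K) ∈ frobeniusFixed K p w ∧ a ^ p ^ w + a = 0 ∧ ActsBy y m σ c a}
  one_mem' := ⟨1, 0, by simp,
    by simp [(Fact.out : p.Prime).ne_zero], ActsBy.one⟩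
  mul_mem' := by
    rintro σ τ ⟨c, a, hc, ha, hσ⟩ ⟨d, b, hd, hb, hτ⟩
    refine ⟨c * d, d * a + b, by simpa using mul_mem hc hd, ?_, hσ.mul hτ⟩
    rw [add_pow_char_pow, mul_pow, mem_frobeniusFixed.1 hd]
    linear_combination (d : K) * ha + hb
  inv_mem' := by
    rintro σ ⟨c, a, hc, ha, hσ⟩
    have hc' : ((c⁻¹ : Kˣ) : K) ∈ frobeniusFixed K p w := by simpa using inv_mem hc
    refine ⟨c⁻¹, _, hc', ?_, hσ.inv⟩
    have h := map_neg (iterateFrobenius K p w) ((c⁻¹ : Kˣ) * a)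
    simp only [iterateFrobenius_def] at h
    rw [h, mul_pow, mem_frobeniusFixed.1 hc']
    linear_combination -((c⁻¹ : Kˣ) : K) * ha

/-- The automorphisms of `T_m` over `K` that fix `y 1, …, y (m - 1)` and send `y m` to `y m + a`
for some `a ∈ W`. -/
def translations (W : AddSubgroup K) : Subgroup (T K y m ≃ₐ[K] T K y m) where
  carrier := {σ | ∃ a ∈ W, ActsBy y m σ 1 a}
  one_mem' := ⟨0, W.zero_mem, ActsBy.one⟩
  mul_mem' := by
    rintro σ τ ⟨a, ha, hσ⟩ ⟨b, hb, hτ⟩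
    exact ⟨a + b, W.add_mem ha hb, by simpa using hσ.mul hτ⟩
  inv_mem' := by
    rintro σ ⟨a, ha, hσ⟩
    exact ⟨-a, W.neg_mem ha, by simpa using hσ.inv⟩

/-- The automorphisms of `T_m` over `K` that send `y i` to `c * y i` for all `1 ≤ i ≤ m`, with one
and the same `c ∈ H`. -/
def scalings (H : Subgroup Kˣ) : Subgroup (T K y m ≃ₐ[K] T K y m) where
  carrier := {σ | ∃ c ∈ H, ActsBy y m σ c 0}
  one_mem' := ⟨1, H.one_mem, ActsBy.one⟩
  mul_mem' := by
    rintro σ τ ⟨c, hc, hσ⟩ ⟨d, hd, hτ⟩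
    exact ⟨c * d, H.mul_mem hc hd, by simpa using hσ.mul hτ⟩
  inv_mem' := by
    rintro σ ⟨c, hc, hσ⟩
    exact ⟨c⁻¹, H.inv_mem hc, by simpa using hσ.inv⟩

end

/-- The subgroup `G` is the (internal) semidirect product `N ⋊ H` of its subgroups `N` and `H`:
`N` is normal in `G`, and every element of `G` is `n * h` for exactly one pair `(n, h) ∈ N × H`. -/
structure IsSemidirect {A : Type*} [Group A] (G N H : Subgroup A) : Prop where
  left_le : N ≤ G
  right_le : H ≤ G
  normal : (N.subgroupOf G).Normal
  complement : Subgroup.IsComplement' (N.subgroupOf G) (H.subgroupOf G)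

end GSTower

/-! Composition gives `(c, a) * (d, b) = (c * d, d * a + b)`, so the group theory is that of affine
maps once every admissible pair `(c, a)` is known to come from exactly one automorphism.

Existence rests on total ramification. Take a valuation, trivial on `K`, with a pole at `y 1`. With
`l = p ^ w`, the equation forces a pole at every `y n` and `v (y (n + 1)) ^ l = v (y n)`. Hence all
nonzero values on `T_n` are powers of `v (y n)`, and `y (n + 1)` has degree `l` over `T_n`
(`IsTower.minpoly_eq`). A homomorphism on `T_n` thus extends to any root of the transformed
equation. Since `c ^ l = c`, `a ^ l = -a` and `X ^ l + X` is additive, `c * y (n + 1) + a` is such a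
root (`IsTower.exists_algHom`). Uniqueness of the pair holds because `y m ∉ K`.

Finally `H` lies in the field of order `p ^ h`, so it preserves `W`; this makes the product a group
with normal subgroup `H_1`. As `h ∣ v`, `W` has `p ^ v` elements. -/

namespace GSTower

open Polynomial IntermediateField

/-! ### Valuations at a pole. -/

section Valuation

variable {E Ω Γ : Type*} [Field E] [Field Ω] [Algebra E Ω] [LinearOrderedCommGroupWithZero Γ]
  (v : Valuation Ω Γ) {x : Ω} {n : ℕ}

/-- If the values of `E` are powers of `v x ^ n`, then the terms of a polynomial in `x` of degree
less than `n` have distinct values. -/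
theorem exists_valuation_aeval_eq_zpow (hx : 1 < v x)
    (hE : ∀ e : E, e ≠ 0 → ∃ k : ℤ, v (algebraMap E Ω e) = (v x ^ n) ^ k)
    {P : E[X]} (hP : P ≠ 0) (hdeg : P.natDegree < n) : ∃ k : ℤ, v (aeval x P) = v x ^ k := by
  classical
  have hx0 : 0 < v x := zero_lt_one.trans hx
  have hinj : Function.Injective fun k : ℤ => v x ^ k := zpow_right_injective₀ hx0 hx.ne'
  have key : ∀ j ∈ P.support, ∃ k : ℤ,
      v (algebraMap E Ω (P.coeff j) * x ^ j) = v x ^ ((n : ℤ) * k + j) := by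
    intro j hj
    obtain ⟨k, hk⟩ := hE _ (mem_support_iff.1 hj)
    exact ⟨k, by rw [map_mul, map_pow, hk, zpow_add₀ hx0.ne', zpow_mul, zpow_natCast, zpow_natCast]⟩
  obtain ⟨j, hj, hmax⟩ := Finset.exists_max_image P.support
    (fun j => v (algebraMap E Ω (P.coeff j) * x ^ j)) (nonempty_support_iff.2 hP)
  obtain ⟨k, hk⟩ := key j hj
  refine ⟨(n : ℤ) * k + j, ?_⟩
  rw [← hk, aeval_eq_sum_range, ← v.map_sum_eq_of_lt (s := P.support)
    (f := fun j => algebraMap E Ω (P.coeff j) * x ^ j) hj]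
  · rw [← aeval_eq_sum_range, aeval_def, eval₂_eq_sum, Polynomial.sum]
  · intro i hi
    obtain ⟨hi, hij⟩ := Finset.mem_sdiff.1 hi
    refine lt_of_le_of_ne (hmax i hi) fun h => hij ?_
    obtain ⟨k', hk'⟩ := key i hi
    rw [hk, hk'] at h
    have h := hinj h
    have hin : i < n := (le_natDegree_of_mem_supp i hi).trans_lt hdeg
    have hjn : j < n := (le_natDegree_of_mem_supp j hj).trans_lt hdeg
    -- Equal values would make `n` divide `i - j`, although `|i - j| < n`.
    have h1 : ((i : ℤ) - j) = n * (k - k') := by linear_combination h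
    have h2 : ((i : ℤ) - j) = 0 :=
      Int.eq_zero_of_abs_lt_dvd ⟨_, h1⟩ (by rw [abs_lt]; omega)
    rw [Finset.mem_singleton]
    omega

/-- A nonzero polynomial of degree below `n` takes at `x` a value with nonzero valuation, so it
cannot vanish there. -/
theorem minpoly_eq_of_valuation (hx : 1 < v x)
    (hE : ∀ e : E, e ≠ 0 → ∃ k : ℤ, v (algebraMap E Ω e) = (v x ^ n) ^ k)
    {f : E[X]} (hf : f.Monic) (hfn : f.natDegree = n) (hfx : aeval x f = 0) :
    minpoly E x = f := by
  refine (minpoly.unique E x hf hfx fun q hq hqx => ?_).symm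
  by_contra h
  obtain ⟨k, hk⟩ := exists_valuation_aeval_eq_zpow v hx hE hq.ne_zero
    (hfn ▸ natDegree_lt_natDegree hq.ne_zero (not_le.1 h))
  rw [hqx, map_zero] at hk
  exact zpow_ne_zero k (zero_lt_one.trans hx).ne' hk.symm

theorem exists_valuation_eq_zpow_of_mem_adjoin (hx : 1 < v x)
    (hval : ∀ P : E[X], aeval x P ≠ 0 → ∃ k : ℤ, v (aeval x P) = v x ^ k)
    {z : Ω} (hz : z ∈ E⟮x⟯) (hz0 : z ≠ 0) : ∃ k : ℤ, v z = v x ^ k := by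
  obtain ⟨r, s, rfl⟩ := (mem_adjoin_simple_iff E z).1 hz
  obtain ⟨hr, hs⟩ := div_ne_zero_iff.1 hz0
  obtain ⟨k, hk⟩ := hval r hr
  obtain ⟨k', hk'⟩ := hval s hs
  exact ⟨k - k', by rw [map_div₀, hk, hk', zpow_sub₀ (zero_lt_one.trans hx).ne']⟩

theorem exists_valuation_eq_zpow_of_algebraic (hx : 1 < v x)
    (hE : ∀ e : E, e ≠ 0 → ∃ k : ℤ, v (algebraMap E Ω e) = (v x ^ n) ^ k)
    {f : E[X]} (hf : f.Monic) (hfn : f.natDegree = n) (hn : n ≠ 0) (hfx : aeval x f = 0)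
    {z : Ω} (hz : z ∈ E⟮x⟯) (hz0 : z ≠ 0) : ∃ k : ℤ, v z = v x ^ k := by
  refine exists_valuation_eq_zpow_of_mem_adjoin v hx (fun P hP => ?_) hz hz0
  have h := aeval_modByMonic_eq_self_of_root (p := P) hfx
  rw [← h]
  refine exists_valuation_aeval_eq_zpow v hx hE (fun h0 => hP ?_)
    (hfn ▸ natDegree_modByMonic_lt P hf fun h1 => hn ?_)
  · rw [← h, h0, map_zero]
  · rw [← hfn, h1, natDegree_one]

theorem exists_valuation_eq_zpow_of_trivial (hx : 1 < v x)
    (hE : ∀ e : E, e ≠ 0 → v (algebraMap E Ω e) = 1)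
    {z : Ω} (hz : z ∈ E⟮x⟯) (hz0 : z ≠ 0) : ∃ k : ℤ, v z = v x ^ k := by
  refine exists_valuation_eq_zpow_of_mem_adjoin v hx (fun P hP => ?_) hz hz0
  -- Constants have value 1, the zeroth power of anything, so `n` may be chosen larger than the
  -- degree of `P`.
  refine exists_valuation_aeval_eq_zpow v (n := P.natDegree + 1) hx
    (fun e he => ⟨0, by rw [hE e he, zpow_zero]⟩) (fun h0 => hP ?_) (Nat.lt_succ_self _)
  rw [h0, map_zero]

/-- At a pole of `x` the denominator is dominated by `x ^ (l - 1)`, so the right side has the value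
of `x`. Then `z` has a pole too, and `z ^ l` dominates `z`. -/
theorem valuation_pow_eq_of_tower {l : ℕ} (hl : 2 ≤ l) {z : Ω} (hx : 1 < v x)
    (h : z ^ l + z = x ^ l / (x ^ (l - 1) + 1)) : 1 < v z ∧ v z ^ l = v x := by
  have hx0 : 0 < v x := zero_lt_one.trans hx
  have h1 : v (x ^ l / (x ^ (l - 1) + 1)) = v x := by
    rw [map_div₀, Valuation.map_add_eq_of_lt_left, map_pow, map_pow,
      div_eq_iff (pow_ne_zero _ hx0.ne'), ← pow_succ', Nat.sub_add_cancel (by omega)]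
    rw [map_one, map_pow]
    exact one_lt_pow₀ hx (by omega)
  rw [← h] at h1
  have hz : 1 < v z := by
    by_contra! hz
    have : v (z ^ l + z) ≤ 1 :=
      v.map_add_le (by rw [map_pow]; exact pow_le_one₀ zero_le hz) hz
    exact absurd (h1 ▸ this) (not_le.2 hx)
  refine ⟨hz, ?_⟩
  rw [← h1, Valuation.map_add_eq_of_lt_left, map_pow]
  rw [map_pow]
  simpa using pow_lt_pow_right₀ hz (show 1 < l by omega)

end Valuation

/-- The integral closure of `K` in `Ω` is the intersection of the valuation rings containing `K`; as
`x` is not integral, one of them omits it. -/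
theorem exists_valuationSubring_of_transcendental {K Ω : Type*} [Field K] [Field Ω] [Algebra K Ω]
    {x : Ω} (hx : Transcendental K x) :
    ∃ A : ValuationSubring Ω, (∀ e : K, e ≠ 0 → A.valuation (algebraMap K Ω e) = 1) ∧
      1 < A.valuation x := by
  have hnot : x ∉ (integralClosure (Subring.closure (Set.range (algebraMap K Ω))) Ω).toSubring := by
    intro hmem
    have hint : IsIntegral (Subring.closure (Set.range (algebraMap K Ω))) x := hmem
    obtain ⟨P, hP, hP0⟩ := hint
    have hlift : P.map (Subring.closure (Set.range (algebraMap K Ω))).subtype ∈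
        Polynomial.lifts (algebraMap K Ω) := by
      rw [lifts_iff_coeff_lifts]
      intro n
      have h : ∀ z ∈ Subring.closure (Set.range (algebraMap K Ω)), z ∈ (algebraMap K Ω).range :=
        fun z hz => Subring.closure_le.2 (by rw [RingHom.coe_range]) hz
      rw [coeff_map]
      exact h _ (P.coeff n).2
    obtain ⟨Q, hQ, -, hQm⟩ := lifts_and_natDegree_eq_and_monic hlift (hP.map _)
    refine hx ⟨Q, hQm.ne_zero, ?_⟩
    rw [aeval_def, ← eval_map, hQ, eval_map]
    exact hP0
  rw [← iInf_valuationSubring_superset, Subring.mem_iInf] at hnot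
  push Not at hnot
  obtain ⟨⟨A, hA⟩, hxA⟩ := hnot
  have hle : ∀ e : K, A.valuation (algebraMap K Ω e) ≤ 1 := fun e =>
    (A.valuation_le_one_iff _).2 (hA ⟨e, rfl⟩)
  refine ⟨A, fun e he => le_antisymm (hle e) ?_, ?_⟩
  · have h := hle e⁻¹
    rw [map_inv₀, map_inv₀] at h
    exact (inv_le_one₀ (by simpa [zero_lt_iff] using he)).1 h
  · rw [← not_le, A.valuation_le_one_iff]
    exact hxA

/-! ### Extension of homomorphisms to simple extensions. -/

theorem exists_ringHom_adjoin_of_minpoly {F L L' : Type*} [Field F] [Field L] [Field L']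
    [Algebra F L] {x : L} (hx : IsIntegral F x) (φ : F →+* L') {x' : L'}
    (hx' : (minpoly F x).eval₂ φ x' = 0) :
    ∃ ψ : F⟮x⟯ →+* L', (∀ e : F, ψ (algebraMap F F⟮x⟯ e) = φ e) ∧
      ψ (AdjoinSimple.gen F x) = x' := by
  let := φ.toAlgebra
  let r : { z // z ∈ (minpoly F x).aroots L' } :=
    ⟨x', mem_aroots.2 ⟨minpoly.ne_zero hx, hx'⟩⟩
  exact ⟨((algHomAdjoinIntegralEquiv F hx).symm r).toRingHom,
    fun e => ((algHomAdjoinIntegralEquiv F hx).symm r).commutes e,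
    algHomAdjoinIntegralEquiv_symm_apply_gen F hx r⟩

theorem exists_algHom_of_minpoly {K Ω : Type*} [Field K] [Field Ω] [Algebra K Ω]
    {E E' : IntermediateField K Ω} {x : Ω} (hE' : E⟮x⟯.restrictScalars K = E')
    (hx : IsIntegral E x) (φ : E →ₐ[K] Ω) {x' : Ω}
    (hx' : (minpoly E x).eval₂ (φ : E →+* Ω) x' = 0) :
    ∃ ψ : E' →ₐ[K] Ω, (∀ z (hz : z ∈ E) (hz' : z ∈ E'), ψ ⟨z, hz'⟩ = φ ⟨z, hz⟩) ∧
      ∀ hz' : x ∈ E', ψ ⟨x, hz'⟩ = x' := by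
  subst hE'
  obtain ⟨ψ, hψ, hψx⟩ := exists_ringHom_adjoin_of_minpoly hx (φ : E →+* Ω) hx'
  exact ⟨{ ψ with commutes' := fun k => (hψ (algebraMap K E k)).trans (φ.commutes k) },
    fun z hz _ => hψ ⟨z, hz⟩, fun _ => hψx⟩

theorem exists_algHom_of_transcendental {K Ω : Type*} [Field K] [Field Ω] [Algebra K Ω]
    {E : IntermediateField K Ω} {x x' : Ω} (hE : K⟮x⟯ = E) (hx : Transcendental K x)
    (hx' : Transcendental K x') :
    ∃ ψ : E →ₐ[K] Ω, ∀ hz : x ∈ E, ψ ⟨x, hz⟩ = x' := by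
  subst hE
  refine ⟨(K⟮x'⟯.val.comp (RatFunc.algEquivOfTranscendental x' hx').toAlgHom).comp
    (RatFunc.algEquivOfTranscendental x hx).symm.toAlgHom, fun hz => ?_⟩
  have h : (⟨x, hz⟩ : K⟮x⟯) = AdjoinSimple.gen K x := rfl
  rw [h]
  simp

/-! ### Ramification and homomorphisms of the tower. -/

section

variable {K : Type*} [Field K] {Ω : Type*} [Field Ω] [Algebra K Ω] {y : ℕ → Ω}

theorem T_one : K⟮y 1⟯ = T K y 1 := by
  simp [T]

theorem T_succ (n : ℕ) : ((T K y n)⟮y (n + 1)⟯).restrictScalars K = T K y (n + 1) := by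
  rw [T, T, adjoin_adjoin_left, ← Set.insert_Icc_right_eq_Icc_add_one (by omega),
    Set.image_insert_eq, Set.union_singleton]

theorem mem_T {i n : ℕ} (h1 : 1 ≤ i) (hn : i ≤ n) : y i ∈ T K y n :=
  subset_adjoin K _ ⟨i, ⟨h1, hn⟩, rfl⟩

theorem monic_artinSchreier {E : Type*} [Field E] {l : ℕ} (hl : 2 ≤ l) (b : E) :
    (X ^ l + X - C b : E[X]).Monic ∧ (X ^ l + X - C b : E[X]).natDegree = l := by
  have h : (X ^ l + X - C b : E[X]) = X ^ l + (X - C b) := by ring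
  have hd : (X - C b : E[X]).degree < (l : WithBot ℕ) := by
    rw [degree_X_sub_C]
    exact_mod_cast (show 1 < l by omega)
  rw [h]
  refine ⟨monic_X_pow_add hd, ?_⟩
  rw [natDegree_add_eq_left_of_natDegree_lt, natDegree_X_pow]
  rw [natDegree_X_pow, natDegree_X_sub_C]
  omega

/-- The element `y n ^ l / (y n ^ (l - 1) + 1)` of `T_n`. -/
noncomputable def rhs (K : Type*) [Field K] {Ω : Type*} [Field Ω] [Algebra K Ω] (y : ℕ → Ω)
    (l n : ℕ) (hn : 1 ≤ n) : T K y n :=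
  (⟨y n, mem_T hn le_rfl⟩ : T K y n) ^ l / ((⟨y n, mem_T hn le_rfl⟩ : T K y n) ^ (l - 1) + 1)

variable {l m : ℕ}

theorem IsTower.aeval_rhs (hy : IsTower K l m y) {n : ℕ} (hn : 1 ≤ n) (hnm : n + 1 ≤ m) :
    aeval (y (n + 1)) (X ^ l + X - C (rhs K y l n hn)) = 0 := by
  have h := hy.equation (n + 1) (by omega) hnm
  rw [Nat.add_sub_cancel] at h
  simp only [map_sub, map_add, map_pow, aeval_X, aeval_C]
  rw [h, sub_eq_zero]
  rfl

theorem IsTower.exists_valuation (hy : IsTower K l m y) (hl : 2 ≤ l) :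
    ∃ A : ValuationSubring Ω, (∀ e : K, e ≠ 0 → A.valuation (algebraMap K Ω e) = 1) ∧
      (∀ n, 1 ≤ n → n ≤ m → 1 < A.valuation (y n) ∧
        ∀ z ∈ T K y n, z ≠ 0 → ∃ k : ℤ, A.valuation z = A.valuation (y n) ^ k) ∧
      ∀ n, 1 ≤ n → n + 1 ≤ m → A.valuation (y (n + 1)) ^ l = A.valuation (y n) := by
  obtain ⟨A, hA, hA1⟩ := exists_valuationSubring_of_transcendental hy.transcendental
  have hstep : ∀ n, 1 ≤ n → n + 1 ≤ m → 1 < A.valuation (y n) →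
      1 < A.valuation (y (n + 1)) ∧ A.valuation (y (n + 1)) ^ l = A.valuation (y n) := by
    intro n hn hnm h
    have he := hy.equation (n + 1) (by omega) hnm
    rw [Nat.add_sub_cancel] at he
    exact valuation_pow_eq_of_tower A.valuation hl h he
  have hall : ∀ n, 1 ≤ n → n ≤ m → 1 < A.valuation (y n) ∧
        ∀ z ∈ T K y n, z ≠ 0 → ∃ k : ℤ, A.valuation z = A.valuation (y n) ^ k := by
    intro n hn
    induction n, hn using Nat.le_induction with
    | base =>
      intro _
      refine ⟨hA1, fun z hz hz0 => ?_⟩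
      rw [← T_one] at hz
      exact exists_valuation_eq_zpow_of_trivial A.valuation hA1 hA hz hz0
    | succ n hn ih =>
      intro hnm
      obtain ⟨h1, h2⟩ := ih (by omega)
      obtain ⟨h3, h4⟩ := hstep n hn hnm h1
      obtain ⟨hf, hfn⟩ := monic_artinSchreier hl (rhs K y l n hn)
      refine ⟨h3, fun z hz hz0 => ?_⟩
      rw [← T_succ] at hz
      refine exists_valuation_eq_zpow_of_algebraic A.valuation h3 (fun e he => ?_) hf hfn
        (by omega) (hy.aeval_rhs hn hnm) hz hz0
      rw [h4]
      exact h2 e e.2 (by simpa using he)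
  exact ⟨A, hA, hall, fun n hn hnm => (hstep n hn hnm (hall n hn (by omega)).1).2⟩

theorem IsTower.notMem_range (hy : IsTower K l m y) (hl : 2 ≤ l) {n : ℕ} (hn : 1 ≤ n)
    (hnm : n ≤ m) (e : K) : y n ≠ algebraMap K Ω e := by
  obtain ⟨A, hA, hall, -⟩ := hy.exists_valuation hl
  intro h
  have h1 := (hall n hn hnm).1
  rw [h] at h1
  rcases eq_or_ne e 0 with rfl | he
  · simp at h1
  · exact absurd (hA e he) h1.ne'

theorem IsTower.minpoly_eq (hy : IsTower K l m y) (hl : 2 ≤ l) {n : ℕ} (hn : 1 ≤ n)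
    (hnm : n + 1 ≤ m) : minpoly (T K y n) (y (n + 1)) = X ^ l + X - C (rhs K y l n hn) := by
  obtain ⟨A, hA, hall, hpow⟩ := hy.exists_valuation hl
  obtain ⟨hf, hfn⟩ := monic_artinSchreier hl (rhs K y l n hn)
  refine minpoly_eq_of_valuation A.valuation (hall (n + 1) (by omega) hnm).1
    (fun e he => ?_) hf hfn (hy.aeval_rhs hn hnm)
  rw [hpow n hn hnm]
  exact (hall n hn (by omega)).2 e e.2 (by simpa using he)

theorem transcendental_affine {x : Ω} (hx : Transcendental K x) {c : K} (hc : c ≠ 0) (a : K) :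
    Transcendental K (algebraMap K Ω c * x + algebraMap K Ω a) := by
  intro h
  refine hx ?_
  have h2 : x = algebraMap K Ω c⁻¹ *
      (algebraMap K Ω c * x + algebraMap K Ω a - algebraMap K Ω a) := by
    rw [add_sub_cancel_right, ← mul_assoc, ← map_mul, inv_mul_cancel₀ hc, map_one, one_mul]
  rw [h2]
  exact (isAlgebraic_algebraMap _).mul (h.sub (isAlgebraic_algebraMap _))

/-- The homomorphisms `T_n → Ω` with `y i ↦ c * y i` for `i < n` and `y n ↦ c * y n + a`. -/
theorem IsTower.exists_algHom {p w : ℕ} [Fact p.Prime] [CharP K p] (hw : 1 ≤ w)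
    (hy : IsTower K (p ^ w) m y) {c : K} (hc0 : c ≠ 0) (hc : c ^ p ^ w = c) {n : ℕ} (hn : 1 ≤ n)
    (hnm : n ≤ m) (a : K) (ha : a ^ p ^ w + a = 0) :
    ∃ ψ : T K y n →ₐ[K] Ω,
      (∀ i (h1 : 1 ≤ i) (hi : i < n), ψ ⟨y i, mem_T h1 hi.le⟩ = algebraMap K Ω c * y i) ∧
      ψ ⟨y n, mem_T hn le_rfl⟩ = algebraMap K Ω c * y n + algebraMap K Ω a := by
  have hp := (Fact.out : p.Prime)
  have hl : 2 ≤ p ^ w := hp.two_le.trans (Nat.le_self_pow (by omega) p)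
  have : CharP Ω p := charP_of_injective_algebraMap (algebraMap K Ω).injective p
  induction n, hn using Nat.le_induction generalizing a with
  | base =>
    obtain ⟨ψ, hψ⟩ := exists_algHom_of_transcendental T_one hy.transcendental
      (transcendental_affine hy.transcendental hc0 a)
    exact ⟨ψ, fun i h1 hi => by omega, hψ _⟩
  | succ n hn ih =>
    -- Only the top generator is translated, so the restriction to `T_n` has translation part 0.
    obtain ⟨φ, hφ, hφn⟩ := ih (by omega) 0 (by simp [hp.ne_zero])
    rw [map_zero, add_zero] at hφn
    have hmin := hy.minpoly_eq hl hn hnm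
    obtain ⟨hf, -⟩ := monic_artinSchreier hl (rhs K y (p ^ w) n hn)
    have hcl : c ^ (p ^ w - 1) = 1 := by
      apply mul_right_cancel₀ hc0
      rw [one_mul, ← pow_succ, Nat.sub_add_cancel (by omega), hc]
    have hrhs : φ (rhs K y (p ^ w) n hn) =
        algebraMap K Ω c * (y n ^ p ^ w / (y n ^ (p ^ w - 1) + 1)) := by
      rw [rhs, map_div₀, map_add, map_pow, map_pow, hφn, map_one, mul_pow, mul_pow, ← map_pow,
        ← map_pow, hc, hcl, map_one, one_mul, mul_div_assoc]
    obtain ⟨ψ, hψ, hψx⟩ := exists_algHom_of_minpoly (T_succ n)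
      ⟨_, hf, hy.aeval_rhs hn hnm⟩ φ
      (x' := algebraMap K Ω c * y (n + 1) + algebraMap K Ω a) (by
        have he := hy.equation (n + 1) (by omega) hnm
        rw [Nat.add_sub_cancel] at he
        rw [hmin]
        simp only [eval₂_sub, eval₂_add, eval₂_X_pow, eval₂_X, eval₂_C, RingHom.coe_coe]
        rw [hrhs, ← he, add_pow_char_pow, mul_pow, ← map_pow, ← map_pow, hc,
          eq_neg_of_add_eq_zero_left ha, map_neg]
        ring)
    refine ⟨ψ, fun i h1 hi => ?_, hψx _⟩
    rw [hψ (y i) (mem_T h1 (by omega))]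
    rcases (show i ≤ n by omega).lt_or_eq with h | rfl
    · exact hφ i h1 h
    · exact hφn

end

/-! ### Automorphisms of `T_m` and their parameters. -/

section

variable {K : Type*} [Field K] {Ω : Type*} [Field Ω] [Algebra K Ω] {y : ℕ → Ω} {m : ℕ}

theorem T_algHom_ext {L : Type*} [Field L] [Algebra K L] {φ χ : T K y m →ₐ[K] L}
    (h : ∀ i : Set.Icc 1 m, φ (gen y m i) = χ (gen y m i)) : φ = χ := by
  refine algHom_ext_of_eq_adjoin _ rfl ?_
  rintro x ⟨i, hi, rfl⟩
  exact h ⟨i, hi⟩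

theorem ActsBy.unique {σ τ : T K y m ≃ₐ[K] T K y m} {c : Kˣ} {a : K}
    (hσ : ActsBy y m σ c a) (hτ : ActsBy y m τ c a) : σ = τ := by
  have h : σ.toAlgHom = τ.toAlgHom := by
    refine T_algHom_ext fun i => ?_
    rcases i.2.2.lt_or_eq with h | h
    · exact (hσ.1 i h).trans (hτ.1 i h).symm
    · exact (hσ.2 i h).trans (hτ.2 i h).symm
  exact AlgEquiv.ext fun z => DFunLike.congr_fun h z

theorem ActsBy.params_eq {l : ℕ} (hl : 2 ≤ l) (hm : 1 ≤ m) (hy : IsTower K l m y)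
    {σ : T K y m ≃ₐ[K] T K y m} {c d : Kˣ} {a b : K}
    (h : ActsBy y m σ c a) (h' : ActsBy y m σ d b) : c = d ∧ a = b := by
  have he := (h.2 ⟨m, hm, le_rfl⟩ rfl).symm.trans (h'.2 ⟨m, hm, le_rfl⟩ rfl)
  have he : algebraMap K Ω c * y m + algebraMap K Ω a =
      algebraMap K Ω d * y m + algebraMap K Ω b := congrArg Subtype.val he
  have hcd : (c : K) = d := by
    by_contra hne
    refine hy.notMem_range hl hm le_rfl ((b - a) / (c - d)) ?_
    have hne' : algebraMap K Ω c - algebraMap K Ω d ≠ 0 := by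
      rw [← map_sub]
      exact (_root_.map_ne_zero _).2 (sub_ne_zero.2 hne)
    rw [map_div₀, map_sub, map_sub, eq_div_iff hne']
    linear_combination he
  refine ⟨Units.ext hcd, (algebraMap K Ω).injective ?_⟩
  rw [hcd] at he
  exact add_left_cancel he

/-- The elements that `ψ` sends into `T_m` form an intermediate field, so testing generators
suffices. -/
theorem mem_T_of_gen {ψ : T K y m →ₐ[K] Ω} (h : ∀ i : Set.Icc 1 m, ψ (gen y m i) ∈ T K y m)
    (z : T K y m) : ψ z ∈ T K y m := by
  have hle : T K y m ≤ ((T K y m).comap ψ).map (T K y m).val := by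
    refine adjoin_le_iff.2 ?_
    rintro _ ⟨i, hi, rfl⟩
    exact ⟨gen y m ⟨i, hi⟩, h ⟨i, hi⟩, rfl⟩
  obtain ⟨z', hz', hzz'⟩ := hle z.2
  rwa [← Subtype.ext hzz']

variable {p w : ℕ} [Fact p.Prime] [CharP K p]

theorem IsTower.exists_endomorphism (hw : 1 ≤ w) (hm : 1 ≤ m) (hy : IsTower K (p ^ w) m y)
    (c : Kˣ) (hc : (c : K) ^ p ^ w = c) (a : K) (ha : a ^ p ^ w + a = 0) :
    ∃ φ : T K y m →ₐ[K] T K y m,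
      (∀ i : Set.Icc 1 m, (i : ℕ) < m → φ (gen y m i) = algebraMap K _ (c : K) * gen y m i) ∧
      ∀ i : Set.Icc 1 m, (i : ℕ) = m →
        φ (gen y m i) = algebraMap K _ (c : K) * gen y m i + algebraMap K _ a := by
  obtain ⟨ψ, hψ, hψm⟩ := hy.exists_algHom hw c.ne_zero hc hm le_rfl a ha
  have h1 : ∀ i : Set.Icc 1 m, (i : ℕ) < m →
      ψ (gen y m i) = (algebraMap K (T K y m) (c : K) * gen y m i : T K y m) :=
    fun i hi => hψ i i.2.1 hi
  have h2 : ∀ i : Set.Icc 1 m, (i : ℕ) = m → ψ (gen y m i) =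
      (algebraMap K (T K y m) (c : K) * gen y m i + algebraMap K (T K y m) a : T K y m) := by
    rintro ⟨i, hi⟩ (rfl : i = m)
    exact hψm
  have hmem : ∀ z, ψ z ∈ (T K y m).toSubalgebra := mem_T_of_gen fun i => by
    rcases i.2.2.lt_or_eq with h | h
    · rw [h1 i h]; exact SetLike.coe_mem _
    · rw [h2 i h]; exact SetLike.coe_mem _
  exact ⟨ψ.codRestrict (T K y m).toSubalgebra hmem, fun i hi => Subtype.ext (h1 i hi),
    fun i hi => Subtype.ext (h2 i hi)⟩

/-- The endomorphisms with parameters `(c, a)` and `(c⁻¹, -c⁻¹ * a)` are mutually inverse on the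
generators. -/
theorem IsTower.exists_actsBy (hw : 1 ≤ w) (hm : 1 ≤ m) (hy : IsTower K (p ^ w) m y)
    (c : Kˣ) (hc : (c : K) ^ p ^ w = c) (a : K) (ha : a ^ p ^ w + a = 0) :
    ∃ σ : T K y m ≃ₐ[K] T K y m, ActsBy y m σ c a := by
  have key : ∀ (d : Kˣ) (b : K) (φ χ : T K y m →ₐ[K] T K y m),
      (∀ i : Set.Icc 1 m, (i : ℕ) < m → φ (gen y m i) = algebraMap K _ (d : K) * gen y m i) →
      (∀ i : Set.Icc 1 m, (i : ℕ) = m →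
        φ (gen y m i) = algebraMap K _ (d : K) * gen y m i + algebraMap K _ b) →
      (∀ i : Set.Icc 1 m, (i : ℕ) < m →
        χ (gen y m i) = algebraMap K _ ((d⁻¹ : Kˣ) : K) * gen y m i) →
      (∀ i : Set.Icc 1 m, (i : ℕ) = m → χ (gen y m i) =
        algebraMap K _ ((d⁻¹ : Kˣ) : K) * gen y m i + algebraMap K _ (-((d⁻¹ : Kˣ) * b))) →
      φ.comp χ = AlgHom.id K _ := by
    intro d b φ χ h1 h2 h3 h4
    have hd : algebraMap K (T K y m) ((d⁻¹ : Kˣ) : K) * algebraMap K (T K y m) (d : K) = 1 := by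
      rw [← map_mul, Units.inv_mul, map_one]
    refine T_algHom_ext fun i => ?_
    rw [AlgHom.comp_apply, AlgHom.id_apply]
    rcases i.2.2.lt_or_eq with h | h
    · rw [h3 i h, map_mul, AlgHom.commutes, h1 i h, ← mul_assoc, hd, one_mul]
    · rw [h4 i h, map_add, map_mul, AlgHom.commutes, AlgHom.commutes, h2 i h, mul_add, ← mul_assoc,
        hd, one_mul, map_neg, map_mul]
      ring
  have hc' : ((c⁻¹ : Kˣ) : K) ^ p ^ w = (c⁻¹ : Kˣ) := by
    rw [Units.val_inv_eq_inv_val, inv_pow, hc]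
  have ha' : (-((c⁻¹ : Kˣ) * a)) ^ p ^ w + (-((c⁻¹ : Kˣ) * a)) = 0 := by
    have h := map_neg (iterateFrobenius K p w) ((c⁻¹ : Kˣ) * a)
    simp only [iterateFrobenius_def] at h
    rw [h, mul_pow, hc']
    linear_combination -((c⁻¹ : Kˣ) : K) * ha
  obtain ⟨φ, h1, h2⟩ := hy.exists_endomorphism hw hm c hc a ha
  obtain ⟨χ, h3, h4⟩ := hy.exists_endomorphism hw hm c⁻¹ hc' _ ha'
  refine ⟨AlgEquiv.ofAlgHom φ χ (key c a φ χ h1 h2 h3 h4)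
    (key c⁻¹ _ χ φ h3 h4 (by simpa using h1) (by simpa using h2)), h1, h2⟩

theorem card_translations (hw : 1 ≤ w) (hm : 1 ≤ m) (hy : IsTower K (p ^ w) m y)
    (W : AddSubgroup K) (hW : ∀ a ∈ W, a ^ p ^ w + a = 0) :
    Nat.card (translations y m W) = Nat.card W := by
  have hl : 2 ≤ p ^ w := (Fact.out : p.Prime).two_le.trans (Nat.le_self_pow (by omega) p)
  choose f hf using fun a : W => hy.exists_actsBy hw hm 1 (by simp) a (hW a a.2)
  refine (Nat.card_eq_of_bijective (fun a : W => (⟨f a, a, a.2, hf a⟩ : translations y m W))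
    ⟨fun a b hab => ?_, ?_⟩).symm
  · have h : f a = f b := congrArg Subtype.val hab
    exact Subtype.ext ((hf a).params_eq hl hm hy (h ▸ hf b)).2
  · rintro ⟨σ, a, ha, hσ⟩
    exact ⟨⟨a, ha⟩, Subtype.ext ((hf ⟨a, ha⟩).unique hσ)⟩

theorem card_scalings (hw : 1 ≤ w) (hm : 1 ≤ m) (hy : IsTower K (p ^ w) m y)
    (H : Subgroup Kˣ) (hH : ∀ c ∈ H, (c : K) ^ p ^ w = c) :
    Nat.card (scalings y m H) = Nat.card H := by
  have hp := (Fact.out : p.Prime)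
  have hl : 2 ≤ p ^ w := hp.two_le.trans (Nat.le_self_pow (by omega) p)
  choose f hf using fun c : H => hy.exists_actsBy hw hm c (hH c c.2) 0 (by simp [hp.ne_zero])
  refine (Nat.card_eq_of_bijective (fun c : H => (⟨f c, c, c.2, hf c⟩ : scalings y m H))
    ⟨fun a b hab => ?_, ?_⟩).symm
  · have h : f a = f b := congrArg Subtype.val hab
    exact Subtype.ext ((hf a).params_eq hl hm hy (h ▸ hf b)).1
  · rintro ⟨σ, c, hc, hσ⟩
    exact ⟨⟨c, hc⟩, Subtype.ext ((hf ⟨c, hc⟩).unique hσ)⟩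

/-! ### The semidirect product. -/

/-- The automorphisms `y i ↦ c * y i` for `i < m` and `y m ↦ c * y m + a`, with `c ∈ H` and
`a ∈ W`, where `W` is stable under `H`. -/
def affineSubgroup (y : ℕ → Ω) (m : ℕ) (W : AddSubgroup K) (H : Subgroup Kˣ)
    (hHW : ∀ c ∈ H, ∀ a ∈ W, (c : K) * a ∈ W) : Subgroup (T K y m ≃ₐ[K] T K y m) where
  carrier := {σ | ∃ c ∈ H, ∃ a ∈ W, ActsBy y m σ c a}
  one_mem' := ⟨1, H.one_mem, 0, W.zero_mem, ActsBy.one⟩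
  mul_mem' := by
    rintro σ τ ⟨c, hc, a, ha, hσ⟩ ⟨d, hd, b, hb, hτ⟩
    exact ⟨c * d, H.mul_mem hc hd, _, W.add_mem (hHW d hd a ha) hb, hσ.mul hτ⟩
  inv_mem' := by
    rintro σ ⟨c, hc, a, ha, hσ⟩
    exact ⟨c⁻¹, H.inv_mem hc, _, W.neg_mem (hHW _ (H.inv_mem hc) a ha), hσ.inv⟩

theorem coe_affineSubgroup (hw : 1 ≤ w) (hm : 1 ≤ m) (hy : IsTower K (p ^ w) m y)
    {W : AddSubgroup K} (hW : ∀ a ∈ W, a ^ p ^ w + a = 0)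
    {H : Subgroup Kˣ} (hH : ∀ c ∈ H, (c : K) ^ p ^ w = c)
    (hHW : ∀ c ∈ H, ∀ a ∈ W, (c : K) * a ∈ W) :
    (affineSubgroup y m W H hHW : Set (T K y m ≃ₐ[K] T K y m)) =
      (translations y m W : Set _) * (scalings y m H : Set _) := by
  have hp := (Fact.out : p.Prime)
  ext σ
  rw [Set.mem_mul]
  constructor
  · rintro ⟨c, hc, a, ha, hσ⟩
    -- The factorization is `(c, a) = (1, c⁻¹ * a) * (c, 0)`.
    have hca := hHW _ (H.inv_mem hc) a ha
    obtain ⟨τ, hτ⟩ := hy.exists_actsBy hw hm 1 (by simp) _ (hW _ hca)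
    obtain ⟨ρ, hρ⟩ := hy.exists_actsBy hw hm c (hH c hc) 0 (by simp [hp.ne_zero])
    refine ⟨τ, ⟨_, hca, hτ⟩, ρ, ⟨c, hc, hρ⟩, (hτ.mul hρ).unique ?_⟩
    simpa using hσ
  · rintro ⟨τ, ⟨a, ha, hτ⟩, ρ, ⟨c, hc, hρ⟩, rfl⟩
    exact ⟨1 * c, by simpa using hc, _, W.add_mem (hHW c hc a ha) W.zero_mem, hτ.mul hρ⟩

theorem isSemidirect_affineSubgroup (hw : 1 ≤ w) (hm : 1 ≤ m) (hy : IsTower K (p ^ w) m y)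
    {W : AddSubgroup K} (hW : ∀ a ∈ W, a ^ p ^ w + a = 0)
    {H : Subgroup Kˣ} (hH : ∀ c ∈ H, (c : K) ^ p ^ w = c)
    (hHW : ∀ c ∈ H, ∀ a ∈ W, (c : K) * a ∈ W) :
    IsSemidirect (affineSubgroup y m W H hHW) (translations y m W) (scalings y m H) := by
  have hl : 2 ≤ p ^ w := (Fact.out : p.Prime).two_le.trans (Nat.le_self_pow (by omega) p)
  have hleft : translations y m W ≤ affineSubgroup y m W H hHW := by
    rintro σ ⟨a, ha, hσ⟩
    exact ⟨1, H.one_mem, a, ha, hσ⟩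
  have hright : scalings y m H ≤ affineSubgroup y m W H hHW := by
    rintro σ ⟨c, hc, hσ⟩
    exact ⟨c, hc, 0, W.zero_mem, hσ⟩
  refine ⟨hleft, hright, ⟨?_⟩, ?_⟩
  · rintro ⟨τ, _⟩ ⟨b, hb, hτ⟩ ⟨σ, c, hc, a, ha, hσ⟩
    -- Conjugating `(1, b)` by `(c, a)` gives `(1, c⁻¹ * b)`; the contributions of `a` cancel.
    refine ⟨(c⁻¹ : Kˣ) * b, hHW _ (H.inv_mem hc) b hb, ?_⟩
    have h := (hσ.mul hτ).mul hσ.inv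
    have h1 : c * 1 * c⁻¹ = 1 := by simp
    have h2 : ((c⁻¹ : Kˣ) : K) * (((1 : Kˣ) : K) * a + b) + -((c⁻¹ : Kˣ) * a) =
        (c⁻¹ : Kˣ) * b := by
      rw [Units.val_one]
      ring
    rw [h1, h2] at h
    exact h
  · refine Subgroup.isComplement'_of_disjoint_and_mul_eq_univ ?_ ?_
    · rw [Subgroup.disjoint_def]
      rintro ⟨σ, _⟩ ⟨a, _, ha⟩ ⟨c, _, hc⟩
      have ha : ActsBy y m σ 1 a := ha
      have hc : ActsBy y m σ c 0 := hc
      obtain ⟨-, rfl⟩ := ha.params_eq hl hm hy hc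
      exact Subtype.ext (ha.unique ActsBy.one)
    · refine Set.eq_univ_of_forall ?_
      rintro ⟨σ, hσ⟩
      have h : σ ∈ (affineSubgroup y m W H hHW : Set (T K y m ≃ₐ[K] T K y m)) := hσ
      rw [coe_affineSubgroup hw hm hy hW hH hHW] at h
      obtain ⟨τ, hτ, ρ, hρ, rfl⟩ := h
      exact ⟨⟨τ, hleft hτ⟩, hτ, ⟨ρ, hright hρ⟩, hρ, rfl⟩

theorem IsSemidirect.card_eq {A : Type*} [Group A] {G N H : Subgroup A} (h : IsSemidirect G N H) :
    Nat.card G = Nat.card N * Nat.card H := by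
  rw [← h.complement.card_mul_card, Nat.card_congr (Subgroup.subgroupOfEquivOfLe h.left_le).toEquiv,
    Nat.card_congr (Subgroup.subgroupOfEquivOfLe h.right_le).toEquiv]

end

/-! ### Orders of finite fields and conclusion. -/

/-- The nonzero elements are the kernel of the power map `p ^ h - 1` on the cyclic group `Kˣ`, of
order `gcd (p ^ N - 1) (p ^ h - 1) = p ^ h - 1`. -/
theorem card_frobeniusFixed {K : Type*} [Field K] [Finite K] {p h N : ℕ} [Fact p.Prime] [CharP K p]
    (hK : Nat.card K = p ^ N) (hhN : h ∣ N) : Nat.card (frobeniusFixed K p h) = p ^ h := by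
  have hp := (Fact.out : p.Prime)
  have hpos : 0 < p ^ h := pow_pos hp.pos h
  have hset : (frobeniusFixed K p h : Set K) =
      insert 0 (Units.val '' ((powMonoidHom (p ^ h - 1) : Kˣ →* Kˣ).ker : Set Kˣ)) := by
    ext x
    rw [SetLike.mem_coe, mem_frobeniusFixed, Set.mem_insert_iff, Set.mem_image]
    constructor
    · intro hx
      rcases eq_or_ne x 0 with rfl | h0
      · exact .inl rfl
      · refine .inr ⟨Units.mk0 x h0, ?_, rfl⟩
        rw [SetLike.mem_coe, MonoidHom.mem_ker, powMonoidHom_apply, Units.ext_iff,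
          Units.val_pow_eq_pow_val,
          Units.val_mk0, Units.val_one]
        apply mul_right_cancel₀ h0
        rw [one_mul, ← pow_succ, Nat.sub_add_cancel hpos, hx]
    · rintro (rfl | ⟨c, hc, rfl⟩)
      · exact zero_pow hpos.ne'
      · rw [SetLike.mem_coe, MonoidHom.mem_ker, powMonoidHom_apply, Units.ext_iff,
          Units.val_pow_eq_pow_val,
          Units.val_one] at hc
        rw [← Nat.sub_add_cancel hpos, pow_succ, hc, one_mul]
  have hcard : Nat.card (powMonoidHom (p ^ h - 1) : Kˣ →* Kˣ).ker = p ^ h - 1 := by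
    rw [IsCyclic.card_powMonoidHom_ker, Nat.card_units, hK, Nat.pow_sub_one_gcd_pow_sub_one,
      Nat.gcd_eq_right hhN]
  rw [← SetLike.coe_sort_coe, hset, Nat.card_coe_set_eq, Set.ncard_insert_of_notMem,
    Set.ncard_image_of_injective _ Units.val_injective, ← Nat.card_coe_set_eq,
    SetLike.coe_sort_coe, hcard, Nat.sub_add_cancel hpos]
  rintro ⟨c, -, hc⟩
  exact c.ne_zero hc

/-- `gcd (p ^ h - 1) (p ^ t - 1) = p ^ gcd h t - 1`, so minimality forces `gcd h t = h`. The case `t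
= 0` is included, as needed for `v = 0`. -/
theorem dvd_of_isLeast {p u h t : ℕ} (hh : IsLeast {t : ℕ | 0 < t ∧ u ∣ p ^ t - 1} h)
    (ht : u ∣ p ^ t - 1) : h ∣ t := by
  have h1 : u ∣ p ^ Nat.gcd h t - 1 := by
    rw [← Nat.pow_sub_one_gcd_pow_sub_one]
    exact Nat.dvd_gcd hh.1.2 ht
  have h2 : h ≤ Nat.gcd h t := hh.2 ⟨Nat.gcd_pos_of_pos_left _ hh.1.1, h1⟩
  rw [Nat.le_antisymm h2 (Nat.gcd_le_left _ hh.1.1)]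
  exact Nat.gcd_dvd_right _ _

end GSTower

theorem proposition2p2 (p w : ℕ) [Fact p.Prime] (hw : 1 ≤ w)
    (K : Type*) [Field K] [Finite K] [CharP K p] (hK : Nat.card K = (p ^ w) ^ 2)
    (Ω : Type*) [Field Ω] [Algebra K Ω] (m : ℕ) (hm : 1 ≤ m)
    (y : ℕ → Ω) (hy : GSTower.IsTower K (p ^ w) m y)
    (v u h : ℕ) (hv : v ≤ w) (hu : 0 < u) (hdvd : u ∣ Nat.gcd (p ^ v - 1) (p ^ w - 1))
    (H : Subgroup Kˣ) (hH : ∀ c ∈ H, (c : K) ∈ GSTower.frobeniusFixed K p w)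
    (hHcard : Nat.card H = u)
    (hh : IsLeast {t : ℕ | 0 < t ∧ u ∣ p ^ t - 1} h)
    (W : Submodule (GSTower.frobeniusFixed K p h) K) (hW : ∀ a ∈ W, a ^ p ^ w + a = 0)
    (hWdim : Module.finrank (GSTower.frobeniusFixed K p h) W = v / h) :
    ∃ G : Subgroup (GSTower.T K y m ≃ₐ[K] GSTower.T K y m),
      (G : Set (GSTower.T K y m ≃ₐ[K] GSTower.T K y m)) =
        (GSTower.translations y m W.toAddSubgroup : Set _) *
          (GSTower.scalings y m H : Set _) ∧
      G ≤ GSTower.affineGroup y m p w ∧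
      GSTower.IsSemidirect G (GSTower.translations y m W.toAddSubgroup)
        (GSTower.scalings y m H) ∧
      Nat.card (GSTower.translations y m W.toAddSubgroup) = p ^ v ∧
      Nat.card (GSTower.scalings y m H) = u ∧
      Nat.card G = u * p ^ v := by
  have hp := (Fact.out : p.Prime)
  have hH' : ∀ c ∈ H, (c : K) ^ p ^ w = c := fun c hc => GSTower.mem_frobeniusFixed.1 (hH c hc)
  have hhv : h ∣ v := GSTower.dvd_of_isLeast hh (hdvd.trans (Nat.gcd_dvd_left _ _))
  have hhw : h ∣ w := GSTower.dvd_of_isLeast hh (hdvd.trans (Nat.gcd_dvd_right _ _))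
  -- Since `u ∣ p ^ h - 1`, every `c ∈ H` satisfies `c ^ p ^ h = c` and is a scalar for `W`.
  have hHW : ∀ c ∈ H, ∀ a ∈ W.toAddSubgroup, (c : K) * a ∈ W.toAddSubgroup := by
    intro c hc a ha
    have hcu : c ^ (p ^ h - 1) = 1 := by
      obtain ⟨k, hk⟩ := hh.1.2
      have hcard : c ^ Nat.card H = 1 := congrArg Subtype.val (pow_card_eq_one' (x := (⟨c, hc⟩ : H)))
      rw [hk, pow_mul, ← hHcard, hcard, one_pow]
    have hcF : (c : K) ∈ GSTower.frobeniusFixed K p h := by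
      rw [GSTower.mem_frobeniusFixed, ← Nat.sub_add_cancel (pow_pos hp.pos h), pow_succ,
        ← Units.val_pow_eq_pow_val, hcu, Units.val_one, one_mul]
    exact W.smul_mem (⟨c, hcF⟩ : GSTower.frobeniusFixed K p h) ha
  have hWcard : Nat.card W.toAddSubgroup = p ^ v := by
    have h1 : Nat.card W = p ^ v := by
      rw [Module.natCard_eq_pow_finrank (K := GSTower.frobeniusFixed K p h), hWdim,
        GSTower.card_frobeniusFixed (N := w * 2) (by rw [hK, pow_mul]) (hhw.mul_right 2),
        ← pow_mul, Nat.mul_div_cancel' hhv]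
    exact h1
  have hsd := GSTower.isSemidirect_affineSubgroup hw hm hy hW hH' hHW
  have hN := (GSTower.card_translations hw hm hy W.toAddSubgroup hW).trans hWcard
  have hS := (GSTower.card_scalings hw hm hy H hH').trans hHcard
  refine ⟨GSTower.affineSubgroup y m W.toAddSubgroup H hHW,
    GSTower.coe_affineSubgroup hw hm hy hW hH' hHW, ?_, hsd, hN, hS, ?_⟩
  · rintro σ ⟨c, hc, a, ha, hσ⟩
    exact ⟨c, a, hH c hc, hW a ha, hσ⟩
  · rw [hsd.card_eq, hN, hS, mul_comm]
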